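/- Let $G=(V,E)$ be a finite simple graph with $n$ nodes. For $S\subseteq V$ let $\delta_G(S)$ be the number of edges between $S$ and $V\setminus S$, and $\mathrm{vol}_G(S)$ the number of edges incident to $S$. $G$ is a $\phi$-expander if $\delta_G(S)/\min\{\mathrm{vol}_G(S),\mathrm{vol}_G(V\setminus S)\}\ge\phi$ for every $S\subseteq V$ such that $S$ and $V\setminus S$ have positive volume. In the adversarial CONGEST model the nodes have unique identifiers, communicate in synchronous rounds by messages of $O(\log n)$ bits over the edges of $G$, and have private independent coins. Initially a node knows only the identifiers of its incident edges, a number $t\ge 1$, and a polynomial estimate $N$ of $n$, $n\le N\le n^{a}$. An adversary that knows the graph, the algorithm and all coins controls a fixed set $F\subseteq E$ of at most $t$ edges, unknown to the nodes, and sends arbitrary messages over the edges of $F$ in both directions. Consider the following algorithm, which uses no communication rounds, with parameters $c_p,C_\ell>0$: for each $i=1,\dots,\ell$, where $\ell=\lceil C_\ell\, t\log N\rceil$, every node $v$ samples each of its incoming directed edges $(u,v)$, $\{u,v\}\in E$, independently with probability $p=\min\{1,c_p/t\}$. Let $G_i$ be the directed graph on $V$ formed by the directed edges sampled for the index $i$;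 the node $v$ thus knows which of its incoming edges belong to $G_i$. **Lemma (Directed covering families for expanders).** For all $a\ge1$ and $c>0$ there are constants $C_{\deg},c_p,C_\ell,C_{\mathrm{num}},C_L>0$, depending only on $a$ and $c$, such that the following holds for every $t\ge1$, every $\phi>0$, every $n$-node $\phi$-expander $G$ of minimum degree at least $C_{\deg}\,t^2\log n/\phi$, and every $N$ with $n\le N\le n^a$. The number of subgraphs satisfies $\ell\le C_{\mathrm{num}}\,t\log n$. Moreover, for every set $F\subseteq E$ of at most $t$ adversarial edges and every strategy of the adversary, with probability at least $1-n^{-c}$ the outputs of the algorithm describe directed subgraphs $G_1,\dots,G_\ell$ of $G$ such that for all $u,v\in V$ and every $E'\subseteq E$ with $|E'|\le 2t$ there is an $i$ with (P1') $\mathrm{dist}_{G_i}(u,v)\le C_L\log n/\phi$ (directed distance), and (P2) $G_i$ contains no edge of $E'$ in either direction. -/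

import Mathlib

open MeasureTheory ProbabilityTheory

universe u

noncomputable section

namespace AdvCongest

/-! ### Expanders -/

/-- `δ_G(S)`: the number of edges of `G` crossing the cut `(S, V \ S)`. -/
def cutSize {V : Type*} (G : SimpleGraph V) (S : Set V) : ℕ :=
  {e ∈ G.edgeSet | (∃ x ∈ S, x ∈ e) ∧ ∃ y ∈ Sᶜ, y ∈ e}.ncard

/-- `vol_G(S)`: the number of edges of `G` incident to `S`. -/
def vol {V : Type*} (G : SimpleGraph V) (S : Set V) : ℕ :=
  {e ∈ G.edgeSet | ∃ x ∈ S, x ∈ e}.ncard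

/-- `φ_G(S) = δ_G(S) / min {vol_G(S), vol_G(V \ S)}`, meaningful if both volumes are positive. -/
def conductance {V : Type*} (G : SimpleGraph V) (S : Set V) : ℝ :=
  (cutSize G S : ℝ) / (min (vol G S) (vol G Sᶜ) : ℕ)

/-- `G` is a `φ`-expander: every cut whose two sides have positive volume has conductance at
least `φ`. -/
def IsExpander {V : Type*} (G : SimpleGraph V) (φ : ℝ) : Prop :=
  ∀ S : Set V, 0 < vol G S → 0 < vol G Sᶜ → φ ≤ conductance G S

/-! ### Directed covering families -/

/-- `DiWalk D k u v`: the digraph `D` has a directed walk with `k` edges from `u` to `v`. -/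
inductive DiWalk {V : Type*} (D : Digraph V) : ℕ → V → V → Prop
  | nil (u : V) : DiWalk D 0 u u
  | cons {k : ℕ} {u v w : V} (h : D.Adj u v) (p : DiWalk D k v w) : DiWalk D (k + 1) u w

/-- The directed distance from `u` to `v` (`⊤` if `v` is not reachable from `u`). -/
def diDist {V : Type*} (D : Digraph V) (u v : V) : ℕ∞ :=
  ⨅ (k : ℕ) (_ : DiWalk D k u v), (k : ℕ∞)

/-- The family `D` consists of directed subgraphs of `G` and, for all nodes `u, v` and every set
`E'` of at most `k` edges of `G`, it has a member in which `v` is at directed distance at most `L`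
from `u` and which contains no edge of `E'`, in neither direction. -/
def IsDirectedCoveringFamily {V ι : Type*} (G : SimpleGraph V) (L : ℝ) (k : ℕ)
    (D : ι → Digraph V) : Prop :=
  (∀ i u v, (D i).Adj u v → G.Adj u v) ∧
  ∀ (u v : V) (E' : Finset (Sym2 V)), (E' : Set (Sym2 V)) ⊆ G.edgeSet → E'.card ≤ k →
    ∃ i, (∃ d : ℕ, diDist (D i) u v = d ∧ (d : ℝ) ≤ L) ∧
      ∀ x y, s(x, y) ∈ E' → ¬ (D i).Adj x y ∧ ¬ (D i).Adj y x

/-! ### The adversarial CONGEST model -/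

/-- What a processor knows about the graph initially: its own identifier and the identifiers of
its neighbours, hence those of its incident edges. -/
structure View where
  id : ℕ
  nbrs : Finset ℕ

/-- The initial view of node `v` in the graph `G` with unique identifiers `ident`. -/
def view {V : Type*} [Fintype V] (G : SimpleGraph V) [DecidableRel G.Adj] (ident : V ↪ ℕ)
    (v : V) : View :=
  ⟨ident v, (G.neighborFinset v).map ident⟩

/-- A randomized synchronous message-passing algorithm with messages of `b` bits. A node tosses
private coins and enters an initial state; in each round it sends a message to every neighbour
(addressed by its identifier), receives the messages of its neighbours (tagged by the identifier
of the sender) and updates its state; after the last round it produces its output.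
Global parameters known to all nodes may enter the algorithm. -/
structure Algorithm (b : ℕ) (Out : Type) where
  Coin : View → Type
  coinSpace : ∀ w, MeasurableSpace (Coin w)
  law : ∀ w, Measure (Coin w)
  isProb : ∀ w, IsProbabilityMeasure (law w)
  State : Type
  init : ∀ w, Coin w → State
  send : State → ℕ → BitVec b
  recv : State → Finset (ℕ × BitVec b) → State
  rounds : ℕ
  output : State → Out

attribute [instance] Algorithm.coinSpace Algorithm.isProb

namespace Algorithm

variable {b : ℕ} {Out : Type} (A : Algorithm b Out) {V : Type*} [Fintype V]
  (G : SimpleGraph V) [DecidableRel G.Adj] (ident : V ↪ ℕ)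

/-- The private coins of all nodes. -/
abbrev Coins : Type _ := ∀ v : V, A.Coin (view G ident v)

/-- The joint law of the private coins: the nodes toss them independently. -/
def coinsLaw : Measure (A.Coins G ident) :=
  Measure.pi fun v => A.law (view G ident v)

/-- A strategy of the adversary: the message put on an adversarial edge in a given round and a
given direction. The adversary is computationally unbounded and knows the graph, the algorithm and
the coins of all nodes, so that the messages exchanged so far are determined by what it knows. -/
abbrev Adversary : Type _ := A.Coins G ident → ℕ → V → V → BitVec b

open Classical in
/-- The state of node `v` after `r` rounds, if the adversary controls the edges in `F`. -/
def stateAt (F : Finset (Sym2 V)) (adv : A.Adversary G ident) (ω : A.Coins G ident) :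
    ℕ → V → A.State
  | 0, v => A.init (view G ident v) (ω v)
  | r + 1, v => A.recv (stateAt F adv ω r v) ((G.neighborFinset v).image fun u =>
      (ident u, if s(u, v) ∈ F then adv ω r u v else A.send (stateAt F adv ω r u) (ident v)))

/-- The output of node `v`, if the adversary controls the edges in `F`. -/
def outputAt (F : Finset (Sym2 V)) (adv : A.Adversary G ident) (ω : A.Coins G ident) (v : V) :
    Out :=
  A.output (A.stateAt G ident F adv ω A.rounds v)

end Algorithm

/-- The directed graphs described by local outputs: for every index `i` a node `v` outputs the
identifiers of those `u` for which the directed edge `(u, v)` belongs to the `i`-th graph. -/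
def outputFamily {V : Type*} (ident : V ↪ ℕ) {l : ℕ} (out : V → Fin l → Finset ℕ) (i : Fin l) :
    Digraph V where
  Adj u v := ident u ∈ out v i

/-! ### The sampling algorithm -/

/-- The sampling probability `min {1, cp / t}`. -/
def rate (cp : ℝ) (t : ℕ) : unitInterval :=
  Set.projIcc 0 1 zero_le_one (cp / t)

/-- The number `⌈Cl * t * log N⌉` of sampled subgraphs. -/
def numSubgraphs (Cl : ℝ) (N t : ℕ) : ℕ := ⌈Cl * t * Real.log N⌉₊

/-- The algorithm without communication in which every node, for each of the `numSubgraphs Cl N t`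
indices and for each of its incoming directed edges, independently samples this edge with
probability `rate cp t`. It uses only the bound `t` on the number of adversarial edges and the
estimate `N` of the number of nodes. -/
def sampling (cp Cl : ℝ) (N t : ℕ) :
    Algorithm (Nat.clog 2 N) (Fin (numSubgraphs Cl N t) → Finset ℕ) where
  Coin w := Fin (numSubgraphs Cl N t) → w.nbrs → Bool
  coinSpace _ := inferInstance
  law _ := Measure.pi fun _ => Measure.pi fun _ => bernoulliMeasure true false (rate cp t)
  isProb _ := inferInstance
  State := Fin (numSubgraphs Cl N t) → Finset ℕ
  init w coin i := (w.nbrs.attach.filter fun x => coin i x = true).map (Function.Embedding.subtype _)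
  send _ _ := 0
  recv s _ := s
  rounds := 0
  output s := s

end AdvCongest

end

/-!
A directed walk leaves `S` along a dart of the cut `(S, V ∖ S)`. In a `φ`-expander of minimum
degree `Δ`, if `S` has at most half of the total degree, then at least `φ Δ (|S| + |T|) / 5` of
these darts avoid a given set `T` of degree sum at most `φ / 4` times that of `S`. A random sample
of the darts misses all of them with a probability exponentially small in `|S| + |T|`, and a union
bound over the pairs `(S, T)` is affordable. Taking for `S` a ball and for `T` the next layer, one
sees that with high probability the degree sums of balls with at most half of the total degree grow
by factors `1 + φ / 4`, in the sampled digraph and in its reverse. After `O(log n / φ)` steps the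
ball out of `u` and the ball into `v` both have more than half of the total degree, hence meet.

A single sample also avoids a fixed set of `2 t` edges with constant probability. The samples are
independent, so all of them fail for a fixed `E'` with probability at most `2⁻ˡ`, which beats the
`n ^ O(t)` choices of `E'`. The adversary has no influence, as no messages are sent.
-/

namespace AdvCongest

section DirectedDistance

variable {V : Type*} {D : Digraph V} {u v w : V} {k l : ℕ}

theorem DiWalk.append (p : DiWalk D k u v) (q : DiWalk D l v w) : DiWalk D (k + l) u w := by
  induction p with
  | nil => rwa [zero_add]
  | cons h _ ih =>
    rw [add_right_comm]
    exact .cons h (ih q)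

theorem diDist_le_iff : diDist D u v ≤ k ↔ ∃ j ≤ k, DiWalk D j u v := by
  constructor
  · contrapose!
    intro h
    have hsucc : ((k + 1 : ℕ) : ℕ∞) ≤ diDist D u v :=
      le_iInf₂ fun j p => by exact_mod_cast not_le.1 fun hj => h j hj p
    exact lt_of_lt_of_le (by exact_mod_cast k.lt_succ_self) hsucc
  · rintro ⟨j, hj, p⟩
    exact (iInf₂_le j p).trans (by exact_mod_cast hj)

theorem diDist_self_le : diDist D u u ≤ k :=
  diDist_le_iff.2 ⟨0, k.zero_le, .nil u⟩

theorem diDist_le_add (huv : diDist D u v ≤ k) (hvw : diDist D v w ≤ l) :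
    diDist D u w ≤ (k + l : ℕ) := by
  obtain ⟨i, hi, p⟩ := diDist_le_iff.1 huv
  obtain ⟨j, hj, q⟩ := diDist_le_iff.1 hvw
  exact diDist_le_iff.2 ⟨i + j, add_le_add hi hj, p.append q⟩

theorem diDist_le_succ_of_adj (huv : diDist D u v ≤ k) (h : D.Adj v w) :
    diDist D u w ≤ (k + 1 : ℕ) :=
  diDist_le_add huv (diDist_le_iff.2 ⟨1, le_rfl, .cons h (.nil w)⟩)

/-- The digraph `D` with all its edges reversed, used to treat distances to a fixed node as
distances from it. -/
def reverse (D : Digraph V) : Digraph V where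
  Adj u v := D.Adj v u

theorem DiWalk.of_reverse (p : DiWalk (reverse D) k u v) : DiWalk D k v u := by
  induction p with
  | nil u => exact .nil u
  | cons h _ ih => exact ih.append (.cons h (.nil _))

theorem diDist_le_of_reverse (h : diDist (reverse D) u v ≤ k) : diDist D v u ≤ k := by
  obtain ⟨j, hj, p⟩ := diDist_le_iff.1 h
  exact diDist_le_iff.2 ⟨j, hj, p.of_reverse⟩

end DirectedDistance

section Expansion

variable {V : Type*} [Fintype V] {w : V → ℝ} {ε : ℝ} {D : Digraph V}

/-- Robust vertex expansion of a digraph with node weights `w`: from every nonempty set `S` of at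
most half of the total weight some edge leaves `S`, even if it must not end in a prescribed set `T`
of weight at most `ε` times that of `S`. -/
def Expands (w : V → ℝ) (ε : ℝ) (D : Digraph V) : Prop :=
  ∀ S T : Finset V, S.Nonempty → 2 * ∑ v ∈ S, w v ≤ ∑ v, w v →
    ∑ v ∈ T, w v ≤ ε * ∑ v ∈ S, w v → ∃ x ∈ S, ∃ y, y ∉ S ∧ y ∉ T ∧ D.Adj x y

open Classical in
/-- The nodes at directed distance at most `k` from `u`. -/
noncomputable def outBall (D : Digraph V) (u : V) (k : ℕ) : Finset V :=
  {v | diDist D u v ≤ k}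

@[simp]
theorem mem_outBall {u v : V} {k : ℕ} : v ∈ outBall D u k ↔ diDist D u v ≤ k := by
  simp [outBall]

theorem outBall_subset_succ (D : Digraph V) (u : V) (k : ℕ) :
    outBall D u k ⊆ outBall D u (k + 1) := fun v hv => by
  rw [mem_outBall] at hv ⊢
  exact hv.trans (by exact_mod_cast k.le_succ)

theorem Expands.sum_outBall_succ (hD : Expands w ε D) (u : V) (k : ℕ)
    (hhalf : 2 * ∑ v ∈ outBall D u k, w v ≤ ∑ v, w v) :
    (1 + ε) * ∑ v ∈ outBall D u k, w v ≤ ∑ v ∈ outBall D u (k + 1), w v := by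
  classical
  have hgrow : ε * ∑ v ∈ outBall D u k, w v <
      ∑ v ∈ outBall D u (k + 1) \ outBall D u k, w v := by
    by_contra! hle
    obtain ⟨x, hx, y, hy, hy', hxy⟩ := hD _ _ ⟨u, mem_outBall.2 diDist_self_le⟩ hhalf hle
    have : y ∈ outBall D u (k + 1) := mem_outBall.2 (diDist_le_succ_of_adj (mem_outBall.1 hx) hxy)
    exact hy' (Finset.mem_sdiff.2 ⟨this, hy⟩)
  linarith [Finset.sum_sdiff (f := w) (outBall_subset_succ D u k)]

theorem Expands.lt_sum_outBall_or_pow_le (hD : Expands w ε D) (hε : 0 ≤ ε) (hw : ∀ v, 1 ≤ w v)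
    (u : V) (k : ℕ) :
    ∑ v, w v < 2 * ∑ v ∈ outBall D u k, w v ∨ (1 + ε) ^ k ≤ ∑ v ∈ outBall D u k, w v := by
  have hw0 : ∀ v, 0 ≤ w v := fun v => zero_le_one.trans (hw v)
  induction k with
  | zero =>
    right
    calc (1 + ε) ^ 0 ≤ w u := by simpa using hw u
      _ ≤ ∑ v ∈ outBall D u 0, w v :=
        Finset.single_le_sum (fun v _ => hw0 v) (mem_outBall.2 diDist_self_le)
  | succ k ih =>
    by_cases hhalf : ∑ v, w v < 2 * ∑ v ∈ outBall D u k, w v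
    · left
      linarith [Finset.sum_le_sum_of_subset_of_nonneg (outBall_subset_succ D u k)
        fun v _ _ => hw0 v]
    · right
      calc (1 + ε) ^ (k + 1) = (1 + ε) * (1 + ε) ^ k := pow_succ' _ _
        _ ≤ (1 + ε) * ∑ v ∈ outBall D u k, w v := by
          gcongr
          exact ih.resolve_left hhalf
        _ ≤ ∑ v ∈ outBall D u (k + 1), w v := hD.sum_outBall_succ u k (not_lt.1 hhalf)

theorem exists_mem_of_half_lt_sum (hw : ∀ v, 0 ≤ w v) {S T : Finset V}
    (hS : ∑ v, w v < 2 * ∑ v ∈ S, w v) (hT : ∑ v, w v < 2 * ∑ v ∈ T, w v) : ∃ v ∈ S, v ∈ T := by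
  classical
  by_contra! h
  have hunion := Finset.sum_union (f := w) (Finset.disjoint_left.2 h)
  linarith [Finset.sum_le_univ_sum_of_nonneg (s := S ∪ T) hw]

theorem Expands.diDist_le (hD : Expands w ε D) (hD' : Expands w ε (reverse D)) (hε : 0 ≤ ε)
    (hw : ∀ v, 1 ≤ w v) {k : ℕ} (hk : ∑ v, w v < (1 + ε) ^ k) (u v : V) :
    diDist D u v ≤ (2 * k : ℕ) := by
  have hw0 : ∀ v, 0 ≤ w v := fun v => zero_le_one.trans (hw v)
  have hsmall : ∀ S : Finset V, ¬ (1 + ε) ^ k ≤ ∑ v ∈ S, w v := fun S =>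
    not_le.2 ((Finset.sum_le_univ_sum_of_nonneg hw0).trans_lt hk)
  have hu := (hD.lt_sum_outBall_or_pow_le hε hw u k).resolve_right (hsmall _)
  have hv := (hD'.lt_sum_outBall_or_pow_le hε hw v k).resolve_right (hsmall _)
  obtain ⟨x, hxu, hxv⟩ := exists_mem_of_half_lt_sum hw0 hu hv
  rw [two_mul]
  exact diDist_le_add (mem_outBall.1 hxu) (diDist_le_of_reverse (mem_outBall.1 hxv))

end Expansion

section DegreeSums

variable {V : Type*} {G : SimpleGraph V}

theorem card_darts_le_two_mul [Finite V] {A : Finset G.Dart} {E : Finset (Sym2 V)}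
    (h : ∀ d ∈ A, d.edge ∈ E) : A.card ≤ 2 * E.card := by
  classical
  have := Fintype.ofFinite V
  refine Finset.card_le_mul_card_image_of_maps_to h 2 fun e _ => ?_
  obtain hempty | ⟨d, hd⟩ := {d ∈ A | d.edge = e}.eq_empty_or_nonempty
  · simp [hempty]
  · obtain rfl := (Finset.mem_filter.1 hd).2
    calc Finset.card {d' ∈ A | d'.edge = d.edge} ≤ Finset.card {d' : G.Dart | d'.edge = d.edge} :=
          Finset.card_le_card (Finset.filter_subset_filter _ (Finset.subset_univ A))
      _ = 2 := G.dart_edge_fiber_card _ d.edge_mem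

variable [Fintype V] [DecidableRel G.Adj]

theorem card_darts_fst_mem [DecidableEq V] (S : Finset V) :
    Finset.card {d : G.Dart | d.fst ∈ S} = ∑ v ∈ S, G.degree v := by
  rw [Finset.card_eq_sum_card_fiberwise (s := ({d : G.Dart | d.fst ∈ S} : Finset _))
    (f := fun d => d.fst) (t := S) fun d hd => by simpa using hd]
  refine Finset.sum_congr rfl fun v hv => ?_
  rw [← G.dart_fst_fiber_card_eq_degree, Finset.filter_filter]
  congr! 2 with d
  exact and_iff_right_of_imp fun h => h ▸ hv

theorem card_darts_snd_mem [DecidableEq V] (S : Finset V) :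
    Finset.card {d : G.Dart | d.snd ∈ S} = ∑ v ∈ S, G.degree v := by
  rw [← card_darts_fst_mem]
  exact Finset.card_nbij' SimpleGraph.Dart.symm SimpleGraph.Dart.symm
    (fun d hd => by simpa using hd) (fun d hd => by simpa using hd)
    (fun d _ => d.symm_symm) (fun d _ => d.symm_symm)

theorem card_mul_minDegree_le_sum_degree (S : Finset V) :
    S.card * G.minDegree ≤ ∑ v ∈ S, G.degree v :=
  Finset.card_nsmul_le_sum _ _ _ fun v _ => G.minDegree_le_degree v

theorem sum_degree_le_two_mul_vol (S : Finset V) : ∑ v ∈ S, G.degree v ≤ 2 * vol G S := by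
  classical
  rw [← card_darts_fst_mem, vol, Set.ncard_eq_toFinset_card _ (Set.toFinite _)]
  refine card_darts_le_two_mul fun d hd => ?_
  rw [Set.Finite.mem_toFinset]
  exact ⟨d.edge_mem, d.fst, (Finset.mem_filter.1 hd).2, Sym2.mem_mk_left _ _⟩

variable [DecidableEq V]

variable (G) in
/-- The darts of `G` that leave `S` and do not end in `T`. -/
def cutDarts (S T : Finset V) : Finset G.Dart :=
  {d | d.fst ∈ S ∧ d.snd ∉ S ∧ d.snd ∉ T}

theorem cutSize_le_card_cutDarts_add (S T : Finset V) :
    cutSize G S ≤ (cutDarts G S T).card + ∑ v ∈ T, G.degree v := by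
  let intoT : Finset G.Dart := {d | d.snd ∈ T}
  have hcut : {e ∈ G.edgeSet | (∃ x ∈ (S : Set V), x ∈ e) ∧ ∃ y ∈ (S : Set V)ᶜ, y ∈ e} ⊆
      ((cutDarts G S T ∪ intoT).image SimpleGraph.Dart.edge : Finset (Sym2 V)) := by
    rintro e ⟨he, ⟨x, hx, hxe⟩, y, hy, hye⟩
    have hne : x ≠ y := fun h => hy (h ▸ hx)
    obtain rfl : e = s(x, y) := (Sym2.mem_and_mem_iff hne).1 ⟨hxe, hye⟩
    refine Finset.mem_image.2 ⟨⟨(x, y), he⟩, ?_, rfl⟩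
    simp only [cutDarts, intoT, Finset.mem_union, Finset.mem_filter_univ]
    by_cases hT : y ∈ T
    · exact .inr hT
    · exact .inl ⟨hx, hy, hT⟩
  calc cutSize G S ≤ _ := (Set.ncard_le_ncard hcut).trans_eq (Set.ncard_coe_finset _)
    _ ≤ (cutDarts G S T ∪ intoT).card := Finset.card_image_le
    _ ≤ (cutDarts G S T).card + ∑ v ∈ T, G.degree v := by
      rw [← card_darts_snd_mem]
      exact Finset.card_union_le _ _

end DegreeSums

section Expanders

variable {V : Type*} {G : SimpleGraph V} {φ : ℝ}

theorem vol_pos_of_adj [Finite V] {S : Set V} {x y : V} (h : G.Adj x y) (hx : x ∈ S) :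
    0 < vol G S :=
  (Set.ncard_pos (Set.toFinite _)).2 ⟨s(x, y), h, x, hx, Sym2.mem_mk_left x y⟩

theorem cutSize_le_vol [Finite V] (G : SimpleGraph V) (S : Set V) : cutSize G S ≤ vol G S :=
  Set.ncard_le_ncard (fun _ he => ⟨he.1, he.2.1⟩) (Set.toFinite _)

theorem cutSize_compl (G : SimpleGraph V) (S : Set V) : cutSize G Sᶜ = cutSize G S := by
  simp only [cutSize, compl_compl, and_comm]

theorem conductance_le_one [Finite V] (G : SimpleGraph V) (S : Set V) : conductance G S ≤ 1 := by
  refine div_le_one_of_le₀ (Nat.cast_le.2 (le_min (cutSize_le_vol G S) ?_)) (Nat.cast_nonneg _)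
  exact cutSize_compl G S ▸ cutSize_le_vol G Sᶜ

theorem IsExpander.le_one [Fintype V] [DecidableRel G.Adj] (hG : IsExpander G φ)
    (hdeg : 0 < G.minDegree) : φ ≤ 1 := by
  obtain ⟨x⟩ : Nonempty V := by
    by_contra hempty
    rw [not_nonempty_iff] at hempty
    exact hdeg.ne' G.minDegree_of_subsingleton
  obtain ⟨y, hxy⟩ := (G.degree_pos_iff_exists_adj x).1 (hdeg.trans_le (G.minDegree_le_degree x))
  exact (hG {x} (vol_pos_of_adj hxy rfl) (vol_pos_of_adj hxy.symm hxy.ne')).trans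
    (conductance_le_one G {x})

variable [Fintype V] [DecidableRel G.Adj] {S T : Finset V}

theorem IsExpander.mul_sum_degree_le_cutSize (hG : IsExpander G φ) (hφ : 0 ≤ φ)
    (hS : 0 < ∑ v ∈ S, G.degree v) (hhalf : 2 * ∑ v ∈ S, G.degree v ≤ ∑ v, G.degree v) :
    φ * ∑ v ∈ S, G.degree v ≤ 2 * cutSize G S := by
  classical
  have hcompl := Finset.sum_add_sum_compl S fun v => G.degree v
  have hvol := sum_degree_le_two_mul_vol (G := G) S
  have hvolc := sum_degree_le_two_mul_vol (G := G) Sᶜ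
  rw [Finset.coe_compl] at hvolc
  have hcond : φ * (min (vol G S) (vol G (S : Set V)ᶜ) : ℕ) ≤ cutSize G S :=
    (le_div_iff₀ (Nat.cast_pos.2 (by omega))).1 (hG S (by omega) (by omega))
  have hmin : ∑ v ∈ S, G.degree v ≤ 2 * min (vol G S) (vol G (S : Set V)ᶜ) := by omega
  calc φ * ∑ v ∈ S, G.degree v
      ≤ φ * (2 * (min (vol G S) (vol G (S : Set V)ᶜ) : ℕ)) := by gcongr; exact_mod_cast hmin
    _ ≤ 2 * cutSize G S := by linarith

variable [DecidableEq V]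

theorem IsExpander.mul_sum_degree_le_card_cutDarts (hG : IsExpander G φ) (hφ : 0 ≤ φ)
    (hS : 0 < ∑ v ∈ S, G.degree v) (hhalf : 2 * ∑ v ∈ S, G.degree v ≤ ∑ v, G.degree v)
    (hT : (∑ v ∈ T, G.degree v : ℕ) ≤ φ / 4 * (∑ v ∈ S, G.degree v : ℕ)) :
    φ * ∑ v ∈ S, G.degree v ≤ 4 * (cutDarts G S T).card := by
  have hcut := hG.mul_sum_degree_le_cutSize hφ hS hhalf
  have hadd : (cutSize G S : ℝ) ≤ (cutDarts G S T).card + (∑ v ∈ T, G.degree v : ℕ) := by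
    exact_mod_cast cutSize_le_card_cutDarts_add S T
  push_cast at *
  linarith

theorem IsExpander.mul_card_add_card_le_card_cutDarts (hG : IsExpander G φ) (hφ : 0 ≤ φ)
    (hdeg : 0 < G.minDegree) (hS : S.Nonempty)
    (hhalf : 2 * ∑ v ∈ S, G.degree v ≤ ∑ v, G.degree v)
    (hT : (∑ v ∈ T, G.degree v : ℕ) ≤ φ / 4 * (∑ v ∈ S, G.degree v : ℕ)) :
    φ * G.minDegree * (S.card + T.card : ℕ) ≤ 5 * (cutDarts G S T).card := by
  have hdegS : (S.card * G.minDegree : ℝ) ≤ (∑ v ∈ S, G.degree v : ℕ) := by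
    exact_mod_cast card_mul_minDegree_le_sum_degree S
  have hdegT : (T.card * G.minDegree : ℝ) ≤ (∑ v ∈ T, G.degree v : ℕ) := by
    exact_mod_cast card_mul_minDegree_le_sum_degree T
  have hpos : 0 < ∑ v ∈ S, G.degree v :=
    (Nat.mul_pos hS.card_pos hdeg).trans_le (card_mul_minDegree_le_sum_degree S)
  have hcut := hG.mul_sum_degree_le_card_cutDarts hφ hpos hhalf hT
  have hcardS : φ * (S.card * G.minDegree) ≤ 4 * (cutDarts G S T).card :=
    (mul_le_mul_of_nonneg_left hdegS hφ).trans hcut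
  have hcardT : φ * (T.card * G.minDegree) ≤ (cutDarts G S T).card :=
    calc φ * (T.card * G.minDegree) ≤ 1 * (T.card * G.minDegree) := by
          gcongr
          exact hG.le_one hdeg
      _ ≤ (cutDarts G S T).card := by linarith
  push_cast
  linarith

end Expanders

section FinsetSums

variable {α : Type*} [Fintype α]

theorem sum_pow_card_finset (x : ℝ) :
    ∑ S : Finset α, x ^ S.card = (1 + x) ^ Fintype.card α := by
  simpa [add_comm] using Fintype.sum_pow_mul_eq_add_pow α x 1

theorem one_add_pow_le_exp_mul {x : ℝ} (hx : 0 ≤ x) (n : ℕ) : (1 + x) ^ n ≤ Real.exp (n * x) := by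
  rw [Real.exp_nat_mul, add_comm]
  gcongr
  exact Real.add_one_le_exp x

theorem exp_le_one_add_two_mul {y : ℝ} (hy : 0 ≤ y) (hy' : y ≤ 1 / 2) :
    Real.exp y ≤ 1 + 2 * y :=
  calc Real.exp y ≤ 1 / (1 - y) := Real.exp_bound_div_one_sub_of_interval hy (by linarith)
    _ ≤ 1 + 2 * y := by
      rw [div_le_iff₀ (by linarith)]
      nlinarith

theorem sum_nonempty_pow_card_add_card_le {x : ℝ} (hx : 0 ≤ x)
    (hsmall : Fintype.card α * x ≤ 1 / 2) :
    ∑ P : Finset α × Finset α with P.1.Nonempty, x ^ (P.1.card + P.2.card) ≤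
      4 * (Fintype.card α * x) := by
  classical
  set y := Fintype.card α * x
  have hpow : (1 + x) ^ Fintype.card α ≤ 1 + 2 * y :=
    (one_add_pow_le_exp_mul hx _).trans (exp_le_one_add_two_mul (by positivity) hsmall)
  have hone : 1 ≤ (1 + x) ^ Fintype.card α := one_le_pow₀ (by linarith)
  have hempty : ({S : Finset α | ¬ S.Nonempty} : Finset _) = {∅} := by
    ext S
    simp [Finset.not_nonempty_iff_eq_empty]
  have hnonempty := Finset.sum_filter_add_sum_filter_not Finset.univ Finset.Nonempty
    fun S : Finset α => x ^ S.card
  rw [hempty, Finset.sum_singleton, Finset.card_empty, pow_zero, sum_pow_card_finset] at hnonempty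
  have hprod : ({P | P.1.Nonempty} : Finset (Finset α × Finset α)) =
      ({S | S.Nonempty} : Finset _) ×ˢ Finset.univ := by
    ext P
    simp
  simp_rw [hprod, Finset.sum_product, pow_add, ← Finset.mul_sum, sum_pow_card_finset]
  rw [← Finset.sum_mul, eq_sub_of_add_eq hnonempty]
  nlinarith

-- Weight every subset `E` by `(1 / card α) ^ #E`.
theorem card_filter_card_le_le [Nonempty α] (k : ℕ) :
    (Finset.card {E : Finset α | E.card ≤ k} : ℝ) ≤ Real.exp 1 * (Fintype.card α : ℝ) ^ k := by
  have hcard : (1 : ℝ) ≤ Fintype.card α := by exact_mod_cast Fintype.card_pos (α := α)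
  set x : ℝ := (Fintype.card α : ℝ)⁻¹
  have hweights : (Finset.card {E : Finset α | E.card ≤ k} : ℝ) * x ^ k ≤ Real.exp 1 :=
    calc (Finset.card {E : Finset α | E.card ≤ k} : ℝ) * x ^ k
        ≤ ∑ E : Finset α with E.card ≤ k, x ^ E.card := by
          rw [← nsmul_eq_mul]
          refine Finset.card_nsmul_le_sum _ _ _ fun E hE => ?_
          exact pow_le_pow_of_le_one (by positivity) (inv_le_one_of_one_le₀ hcard)
            (Finset.mem_filter.1 hE).2
      _ ≤ ∑ E : Finset α, x ^ E.card :=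
          Finset.sum_le_sum_of_subset_of_nonneg (Finset.filter_subset _ _)
            fun _ _ _ => by positivity
      _ ≤ Real.exp 1 := by
          rw [sum_pow_card_finset]
          refine (one_add_pow_le_exp_mul (by positivity) _).trans_eq ?_
          rw [mul_inv_cancel₀ (by positivity)]
  rwa [inv_pow, ← div_eq_mul_inv, div_le_iff₀ (by positivity)] at hweights

end FinsetSums

section BernoulliSubdigraph

variable {V Ω : Type*} {G : SimpleGraph V} {mΩ : MeasurableSpace Ω} {μ : Measure Ω}
  {p : unitInterval} {D : Ω → Digraph V} {φ : ℝ}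

/-- The random digraph `D` consists of the darts of `G`, each kept independently with probability
`p`. Independence is encoded by the probabilities of avoiding a set of darts, which determine the
law of `D`. -/
structure IsBernoulliSubdigraph (G : SimpleGraph V) (μ : Measure Ω) (p : unitInterval)
    (D : Ω → Digraph V) : Prop where
  adj {ω : Ω} {x y : V} : (D ω).Adj x y → G.Adj x y
  measurableSet_adj (x y : V) : MeasurableSet {ω | (D ω).Adj x y}
  measureReal_avoids (A : Finset G.Dart) :
    μ.real {ω | ∀ d ∈ A, ¬ (D ω).Adj d.fst d.snd} = (1 - p : ℝ) ^ A.card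

namespace IsBernoulliSubdigraph

theorem comp_reverse (hD : IsBernoulliSubdigraph G μ p D) :
    IsBernoulliSubdigraph G μ p fun ω => reverse (D ω) where
  adj h := (hD.adj h).symm
  measurableSet_adj x y := hD.measurableSet_adj y x
  measureReal_avoids A := by
    have := hD.measureReal_avoids (A.map ⟨_, SimpleGraph.Dart.symm_involutive.injective⟩)
    rw [Finset.card_map] at this
    simp only [Finset.forall_mem_map] at this
    exact this

theorem measureReal_adj [IsProbabilityMeasure μ] (hD : IsBernoulliSubdigraph G μ p D)
    (d : G.Dart) : μ.real {ω | (D ω).Adj d.fst d.snd} = p := by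
  have havoid := hD.measureReal_avoids {d}
  simp only [Finset.mem_singleton, forall_eq, Finset.card_singleton, pow_one] at havoid
  have := probReal_compl_eq_one_sub (μ := μ) (hD.measurableSet_adj d.fst d.snd)
  rw [Set.compl_ofPred, havoid] at this
  linarith

theorem measureReal_meets_le [Finite V] [IsProbabilityMeasure μ]
    (hD : IsBernoulliSubdigraph G μ p D) (E : Finset (Sym2 V)) :
    μ.real {ω | ∃ x y, s(x, y) ∈ E ∧ (D ω).Adj x y} ≤ 2 * E.card * p := by
  classical
  have := Fintype.ofFinite V
  let A : Finset G.Dart := {d | d.edge ∈ E}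
  have hA : A.card ≤ 2 * E.card := card_darts_le_two_mul fun d hd => (Finset.mem_filter.1 hd).2
  have hcover : {ω | ∃ x y, s(x, y) ∈ E ∧ (D ω).Adj x y} ⊆
      ⋃ d ∈ A, {ω | (D ω).Adj d.fst d.snd} := by
    rintro ω ⟨x, y, hE, hxy⟩
    exact Set.mem_iUnion₂.2 ⟨⟨(x, y), hD.adj hxy⟩, by simpa [A] using hE, hxy⟩
  calc μ.real {ω | ∃ x y, s(x, y) ∈ E ∧ (D ω).Adj x y}
      ≤ ∑ d ∈ A, μ.real {ω | (D ω).Adj d.fst d.snd} :=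
        (measureReal_mono hcover (measure_ne_top _ _)).trans (measureReal_biUnion_finset_le _ _)
    _ = A.card * p := by simp [hD.measureReal_adj]
    _ ≤ 2 * E.card * p := by
      gcongr
      · exact p.2.1
      · exact_mod_cast hA

variable [Fintype V] [DecidableRel G.Adj]

theorem measureReal_avoids_cutDarts_le [DecidableEq V] (hD : IsBernoulliSubdigraph G μ p D)
    (hG : IsExpander G φ) (hφ : 0 ≤ φ) (hdeg : 0 < G.minDegree) {S T : Finset V}
    (hS : S.Nonempty) (hhalf : 2 * ∑ v ∈ S, G.degree v ≤ ∑ v, G.degree v)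
    (hT : (∑ v ∈ T, G.degree v : ℕ) ≤ φ / 4 * (∑ v ∈ S, G.degree v : ℕ)) :
    μ.real {ω | ∀ d ∈ cutDarts G S T, ¬ (D ω).Adj d.fst d.snd} ≤
      Real.exp (-(p * φ * G.minDegree / 5)) ^ (S.card + T.card) := by
  have hcut := hG.mul_card_add_card_le_card_cutDarts hφ hdeg hS hhalf hT
  calc μ.real {ω | ∀ d ∈ cutDarts G S T, ¬ (D ω).Adj d.fst d.snd}
      = (1 - p : ℝ) ^ (cutDarts G S T).card := hD.measureReal_avoids _
    _ ≤ Real.exp (-p) ^ (cutDarts G S T).card :=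
        pow_le_pow_left₀ (sub_nonneg.2 p.2.2) (Real.one_sub_le_exp_neg p) _
    _ ≤ Real.exp (-(p * φ * G.minDegree / 5)) ^ (S.card + T.card) := by
      rw [← Real.exp_nat_mul, ← Real.exp_nat_mul, Real.exp_le_exp]
      linarith [mul_le_mul_of_nonneg_left hcut p.2.1]

theorem measureReal_not_expands_le [IsProbabilityMeasure μ] (hD : IsBernoulliSubdigraph G μ p D)
    (hG : IsExpander G φ) (hφ : 0 ≤ φ) (hdeg : 0 < G.minDegree) :
    μ.real {ω | ¬ Expands (fun v => (G.degree v : ℝ)) (φ / 4) (D ω)} ≤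
      4 * (Fintype.card V * Real.exp (-(p * φ * G.minDegree / 5))) := by
  classical
  set x := Real.exp (-(p * φ * G.minDegree / 5))
  obtain hlarge | hsmall := lt_or_ge (1 / 2) (Fintype.card V * x)
  · exact measureReal_le_one.trans (by linarith)
  let sets : Finset (Finset V × Finset V) := {P | P.1.Nonempty ∧
    2 * ∑ v ∈ P.1, G.degree v ≤ ∑ v, G.degree v ∧
    (∑ v ∈ P.2, G.degree v : ℕ) ≤ φ / 4 * (∑ v ∈ P.1, G.degree v : ℕ)}
  have hcover : {ω | ¬ Expands (fun v => (G.degree v : ℝ)) (φ / 4) (D ω)} ⊆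
      ⋃ P ∈ sets, {ω | ∀ d ∈ cutDarts G P.1 P.2, ¬ (D ω).Adj d.fst d.snd} := by
    intro ω hω
    simp only [Expands, Set.mem_ofPred_eq, not_forall, not_exists] at hω
    obtain ⟨S, T, hS, hhalf, hT, havoid⟩ := hω
    refine Set.mem_iUnion₂.2 ⟨(S, T), Finset.mem_filter.2
      ⟨Finset.mem_univ _, hS, by exact_mod_cast hhalf, by exact_mod_cast hT⟩, fun d hd hadj => ?_⟩
    obtain ⟨hfst, hsnd, hsnd'⟩ := (Finset.mem_filter.1 hd).2
    exact havoid d.fst ⟨hfst, d.snd, hsnd, hsnd', hadj⟩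
  calc μ.real {ω | ¬ Expands (fun v => (G.degree v : ℝ)) (φ / 4) (D ω)}
      ≤ ∑ P ∈ sets, μ.real {ω | ∀ d ∈ cutDarts G P.1 P.2, ¬ (D ω).Adj d.fst d.snd} :=
        (measureReal_mono hcover (measure_ne_top _ _)).trans (measureReal_biUnion_finset_le _ _)
    _ ≤ ∑ P ∈ sets, x ^ (P.1.card + P.2.card) := Finset.sum_le_sum fun P hP => by
        obtain ⟨hS, hhalf, hT⟩ := (Finset.mem_filter.1 hP).2
        exact hD.measureReal_avoids_cutDarts_le hG hφ hdeg hS hhalf hT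
    _ ≤ ∑ P : Finset V × Finset V with P.1.Nonempty, x ^ (P.1.card + P.2.card) :=
        Finset.sum_le_sum_of_subset_of_nonneg
          (Finset.monotone_filter_right _ fun _ _ h => h.1) fun _ _ _ => by positivity
    _ ≤ 4 * (Fintype.card V * x) := sum_nonempty_pow_card_add_card_le (by positivity) hsmall

end IsBernoulliSubdigraph

end BernoulliSubdigraph

section Covering

variable {V : Type*}

/-- The digraph `D` covers the edge set `E` within distance `L`: all its directed distances are at
most `L`, and it contains no edge of `E`, in neither direction. -/
def Covers (L : ℝ) (E : Finset (Sym2 V)) (D : Digraph V) : Prop :=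
  (∀ u v, ∃ d : ℕ, diDist D u v = d ∧ (d : ℝ) ≤ L) ∧ ∀ x y, s(x, y) ∈ E → ¬ D.Adj x y

theorem isDirectedCoveringFamily_of_covers {ι : Type*} {G : SimpleGraph V} {L : ℝ} {k : ℕ}
    {D : ι → Digraph V} (hD : ∀ i x y, (D i).Adj x y → G.Adj x y)
    (hcovers : ∀ E : Finset (Sym2 V), E.card ≤ k → ∃ i, Covers L E (D i)) :
    IsDirectedCoveringFamily G L k D := by
  refine ⟨hD, fun u v E _ hE => ?_⟩
  obtain ⟨i, hdist, havoid⟩ := hcovers E hE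
  exact ⟨i, hdist u v, fun x y hxy => ⟨havoid x y hxy, havoid y x (Sym2.eq_swap ▸ hxy)⟩⟩

theorem half_le_log {n : ℕ} (hn : 2 ≤ n) : 1 / 2 ≤ Real.log n :=
  calc (1 / 2 : ℝ) ≤ Real.log 2 := by linarith [Real.log_two_gt_d9]
    _ ≤ Real.log n := Real.log_le_log two_pos (by exact_mod_cast hn)

theorem exists_sq_le_one_add_pow {n : ℕ} {φ : ℝ} (hn : 2 ≤ n) (hφ : 0 < φ) (hφ' : φ ≤ 1) :
    ∃ k : ℕ, (n : ℝ) ^ 2 ≤ (1 + φ / 4) ^ k ∧ ((2 * k : ℕ) : ℝ) ≤ 36 * Real.log n / φ := by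
  have hlog := half_le_log hn
  have hstep : Real.exp (φ / 8) ≤ 1 + φ / 4 := by
    linarith [exp_le_one_add_two_mul (y := φ / 8) (by positivity) (by linarith)]
  set k := ⌈16 * Real.log n / φ⌉₊
  refine ⟨k, ?_, ?_⟩
  · have hk : 16 * Real.log n ≤ k * φ := (div_le_iff₀ hφ).1 (Nat.le_ceil _)
    calc (n : ℝ) ^ 2 = Real.exp (2 * Real.log n) := by
          rw [mul_comm, Real.exp_mul, Real.exp_log (by positivity)]
          norm_cast
      _ ≤ Real.exp (k * (φ / 8)) := Real.exp_le_exp.2 (by linarith)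
      _ = Real.exp (φ / 8) ^ k := Real.exp_nat_mul _ _
      _ ≤ (1 + φ / 4) ^ k := by gcongr
  · have hk : k < 16 * Real.log n / φ + 1 := Nat.ceil_lt_add_one (by positivity)
    have hround : 2 ≤ 4 * Real.log n / φ := by
      rw [le_div_iff₀ hφ]
      linarith
    push_cast
    linarith [show 36 * Real.log n / φ = 2 * (16 * Real.log n / φ) + 4 * Real.log n / φ by ring]

variable [Fintype V] {G : SimpleGraph V} {Ω : Type*} {mΩ : MeasurableSpace Ω} {μ : Measure Ω}
  [IsProbabilityMeasure μ] {p : unitInterval} {D : Ω → Digraph V} {φ : ℝ}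

theorem measureReal_not_isDirectedCoveringFamily_le [Nonempty V] {L q : ℝ} {k : ℕ}
    (hD : ∀ ω x y, (D ω).Adj x y → G.Adj x y)
    (hq : ∀ E : Finset (Sym2 V), E.card ≤ k → μ.real {ω | ¬ Covers L E (D ω)} ≤ q)
    (ι : Type*) [Fintype ι] :
    (Measure.pi fun _ : ι => μ).real {ω | ¬ IsDirectedCoveringFamily G L k fun i => D (ω i)} ≤
      Real.exp 1 * (Fintype.card (Sym2 V) : ℝ) ^ k * q ^ Fintype.card ι := by
  classical
  have : Nonempty (Sym2 V) := .map Sym2.diag inferInstance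
  let fails (E : Finset (Sym2 V)) : Set (ι → Ω) := Set.univ.pi fun _ => {ω | ¬ Covers L E (D ω)}
  have hcover : {ω | ¬ IsDirectedCoveringFamily G L k fun i => D (ω i)} ⊆
      ⋃ E ∈ ({E | E.card ≤ k} : Finset (Finset (Sym2 V))), fails E := by
    intro ω hω
    by_contra hgood
    refine hω (isDirectedCoveringFamily_of_covers (fun i => hD (ω i)) fun E hE => ?_)
    by_contra! hfail
    exact hgood (Set.mem_iUnion₂.2 ⟨E, (Finset.mem_filter_univ _).2 hE, fun i _ => hfail i⟩)
  have hfails : ∀ E : Finset (Sym2 V), E.card ≤ k →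
      (Measure.pi fun _ => μ).real (fails E) ≤ q ^ Fintype.card ι := by
    intro E hE
    rw [measureReal_def, Measure.pi_pi, Finset.prod_const, ENNReal.toReal_pow, Finset.card_univ]
    exact pow_le_pow_left₀ measureReal_nonneg (hq E hE) _
  have hq0 : 0 ≤ q := measureReal_nonneg.trans (hq ∅ k.zero_le)
  calc (Measure.pi fun _ : ι => μ).real {ω | ¬ IsDirectedCoveringFamily G L k fun i => D (ω i)}
      ≤ ∑ E : Finset (Sym2 V) with E.card ≤ k, (Measure.pi fun _ => μ).real (fails E) :=
        (measureReal_mono hcover (measure_ne_top _ _)).trans (measureReal_biUnion_finset_le _ _)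
    _ ≤ Finset.card {E : Finset (Sym2 V) | E.card ≤ k} * q ^ Fintype.card ι := by
        rw [← nsmul_eq_mul]
        exact Finset.sum_le_card_nsmul _ _ _ fun E hE => hfails E (Finset.mem_filter.1 hE).2
    _ ≤ Real.exp 1 * (Fintype.card (Sym2 V) : ℝ) ^ k * q ^ Fintype.card ι := by
        gcongr
        exact card_filter_card_le_le k

variable [DecidableRel G.Adj]

theorem sum_degree_lt_card_sq [Nonempty V] : ∑ v, G.degree v < Fintype.card V ^ 2 :=
  calc ∑ v, G.degree v < ∑ _v : V, Fintype.card V :=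
        Finset.sum_lt_sum_of_nonempty Finset.univ_nonempty fun v _ => G.degree_lt_card_verts v
    _ = Fintype.card V ^ 2 := by simp [sq]

theorem Expands.exists_diDist_eq {D : Digraph V} (hV : 2 ≤ Fintype.card V)
    (hφ : 0 < φ) (hφ' : φ ≤ 1) (hdeg : 0 < G.minDegree)
    (hD : Expands (fun v => (G.degree v : ℝ)) (φ / 4) D)
    (hD' : Expands (fun v => (G.degree v : ℝ)) (φ / 4) (reverse D)) (u v : V) :
    ∃ d : ℕ, diDist D u v = d ∧ (d : ℝ) ≤ 36 * Real.log (Fintype.card V) / φ := by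
  have : Nonempty V := ⟨u⟩
  obtain ⟨k, hpow, hk⟩ := exists_sq_le_one_add_pow hV hφ hφ'
  have hsum : ∑ v, (G.degree v : ℝ) < (1 + φ / 4) ^ k :=
    lt_of_lt_of_le (by exact_mod_cast sum_degree_lt_card_sq) hpow
  have hw : ∀ v, 1 ≤ (G.degree v : ℝ) := fun v => by
    exact_mod_cast hdeg.trans_le (G.minDegree_le_degree v)
  have hdist := hD.diDist_le hD' (by positivity) hw hsum u v
  obtain ⟨d, hd⟩ := ENat.ne_top_iff_exists.1 (ne_top_of_le_ne_top (ENat.natCast_ne_top _) hdist)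
  rw [← hd] at hdist ⊢
  exact ⟨d, rfl, hk.trans' (by exact_mod_cast hdist)⟩

theorem IsBernoulliSubdigraph.measureReal_not_expands_le_eighth (hD : IsBernoulliSubdigraph G μ p D)
    (hV : 2 ≤ Fintype.card V) (hG : IsExpander G φ) (hφ : 0 ≤ φ) (hdeg : 0 < G.minDegree)
    (hp : 30 * Real.log (Fintype.card V) ≤ p * φ * G.minDegree) :
    μ.real {ω | ¬ Expands (fun v => (G.degree v : ℝ)) (φ / 4) (D ω)} ≤ 1 / 8 := by
  have hV' : (2 : ℝ) ≤ Fintype.card V := by exact_mod_cast hV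
  refine (hD.measureReal_not_expands_le hG hφ hdeg).trans ?_
  calc 4 * (Fintype.card V * Real.exp (-(p * φ * G.minDegree / 5)))
      ≤ 4 * (Fintype.card V * Real.exp (-(6 * Real.log (Fintype.card V)))) := by
        gcongr
        linarith
    _ = 4 / (Fintype.card V : ℝ) ^ 5 := by
        rw [Real.exp_neg, mul_comm 6, Real.exp_mul, Real.exp_log (by positivity)]
        norm_cast
        field_simp
        norm_cast
        ring
    _ ≤ 4 / 2 ^ 5 := by gcongr
    _ = 1 / 8 := by norm_num

theorem IsBernoulliSubdigraph.measureReal_not_covers_le (hD : IsBernoulliSubdigraph G μ p D)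
    (hV : 2 ≤ Fintype.card V) (hG : IsExpander G φ) (hφ : 0 < φ) (hdeg : 0 < G.minDegree)
    (hp : 30 * Real.log (Fintype.card V) ≤ p * φ * G.minDegree)
    {E : Finset (Sym2 V)} (hE : 8 * E.card * (p : ℝ) ≤ 1) :
    μ.real {ω | ¬ Covers (36 * Real.log (Fintype.card V) / φ) E (D ω)} ≤ 1 / 2 := by
  set w : V → ℝ := fun v => G.degree v
  have hcover : {ω | ¬ Covers (36 * Real.log (Fintype.card V) / φ) E (D ω)} ⊆
      {ω | ¬ Expands w (φ / 4) (D ω)} ∪ {ω | ¬ Expands w (φ / 4) (reverse (D ω))} ∪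
        {ω | ∃ x y, s(x, y) ∈ E ∧ (D ω).Adj x y} := by
    intro ω hω
    by_contra! hgood
    simp only [Set.mem_union, Set.mem_ofPred_eq, not_or, not_not] at hgood
    obtain ⟨⟨hout, hin⟩, havoid⟩ := hgood
    exact hω ⟨hout.exists_diDist_eq hV hφ (hG.le_one hdeg) hdeg hin,
      fun x y hxy hadj => havoid ⟨x, y, hxy, hadj⟩⟩
  have hout := hD.measureReal_not_expands_le_eighth hV hG hφ.le hdeg hp
  have hin := hD.comp_reverse.measureReal_not_expands_le_eighth hV hG hφ.le hdeg hp
  refine (measureReal_mono hcover).trans ((measureReal_union_le _ _).trans ?_)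
  refine (add_le_add (measureReal_union_le _ _) (hD.measureReal_meets_le E)).trans ?_
  linarith

end Covering

theorem map_swap_pi_pi {ι κ : Type*} [Fintype ι] [Fintype κ] {X : ι → κ → Type*}
    [∀ i j, MeasurableSpace (X i j)] (μ : ∀ i j, Measure (X i j)) [∀ i j, SigmaFinite (μ i j)] :
    (Measure.pi fun i => Measure.pi (μ i)).map (fun ω j i => ω i j) =
      Measure.pi fun j => Measure.pi fun i => μ i j := by
  refine (Measure.pi_eq_generateFrom (fun _ => generateFrom_pi) (fun _ => isPiSystem_pi)
    (fun j => Measure.FiniteSpanningSetsIn.pi fun i => (μ i j).toFiniteSpanningSetsIn) ?_).symm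
  intro s hs
  choose u hu hs using hs
  obtain rfl : (fun j => Set.univ.pi (u j)) = s := funext hs
  have hmeas : Measurable fun (ω : ∀ i j, X i j) j i => ω i j := by fun_prop
  have hpre : (fun (ω : ∀ i j, X i j) j i => ω i j) ⁻¹' Set.univ.pi (fun j => Set.univ.pi (u j)) =
      Set.univ.pi fun i => Set.univ.pi fun j => u j i := by
    ext ω
    simp only [Set.mem_preimage, Set.mem_univ_pi]
    exact forall_comm
  have hbox : MeasurableSet (Set.univ.pi fun j => Set.univ.pi (u j)) :=
    .univ_pi fun j => .univ_pi fun i => hu j i trivial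
  rw [Measure.map_apply hmeas hbox, hpre]
  simp only [Measure.pi_pi]
  exact Finset.prod_comm

theorem measureReal_pi_pi_bernoulliMeasure_forall_eq_false {ι : Type*} [Fintype ι]
    {κ : ι → Type*} [∀ i, Fintype (κ i)] (p : unitInterval) (B : Finset (Σ i, κ i)) :
    (Measure.pi fun i => Measure.pi fun _ : κ i => bernoulliMeasure true false p).real
      {ω | ∀ b ∈ B, ω b.1 b.2 = false} = (1 - p : ℝ) ^ B.card := by
  classical
  have hbox : {ω : ∀ i, κ i → Bool | ∀ b ∈ B, ω b.1 b.2 = false} =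
      Set.univ.pi fun i => Set.univ.pi fun x => if ⟨i, x⟩ ∈ B then {false} else Set.univ := by
    ext ω
    simp only [Set.mem_ofPred_eq, Set.mem_univ_pi, Sigma.forall]
    refine forall₂_congr fun i x => ?_
    split_ifs with h <;> simp [h]
  have hcoin : ∀ b : Σ i, κ i,
      (bernoulliMeasure true false p).real (if b ∈ B then {false} else Set.univ) =
        if b ∈ B then 1 - (p : ℝ) else 1 := by
    intro b
    split_ifs
    · exact bernoulliMeasure_real_apply_of_notMem_of_mem _ (measurableSet_singleton _)
        (by simp) (by simp)
    · exact probReal_univ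
  rw [hbox, measureReal_def]
  simp only [Measure.pi_pi, ENNReal.toReal_prod, ← measureReal_def, hcoin]
  rw [← Fintype.prod_sigma fun b : Σ i, κ i => if b ∈ B then 1 - (p : ℝ) else 1]
  simp

section Sampling

variable {V : Type*} [Fintype V] (G : SimpleGraph V) [DecidableRel G.Adj] (ident : V ↪ ℕ)

/-- The coins that the nodes toss for one of the sampled subgraphs: node `v` tosses one for each of
its incoming edges, named by the identifier of the other end. -/
abbrev RoundCoins : Type _ := ∀ v : V, (view G ident v).nbrs → Bool

/-- The law of the coins for one of the sampled subgraphs. -/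
noncomputable def roundLaw (p : unitInterval) : Measure (RoundCoins G ident) :=
  Measure.pi fun _ => Measure.pi fun _ => bernoulliMeasure true false p

instance (p : unitInterval) : IsProbabilityMeasure (roundLaw G ident p) := by
  unfold roundLaw
  infer_instance

/-- The directed graph described by the coins for one of the sampled subgraphs. -/
def roundGraph (ω : RoundCoins G ident) : Digraph V where
  Adj u v := ident u ∈ ((view G ident v).nbrs.attach.filter fun x => ω v x = true).map
    (Function.Embedding.subtype _)

variable {G ident}

theorem mem_nbrs_view {u v : V} : ident u ∈ (view G ident v).nbrs ↔ G.Adj u v := by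
  simp [view, SimpleGraph.adj_comm]

theorem roundGraph_adj {ω : RoundCoins G ident} {u v : V} :
    (roundGraph G ident ω).Adj u v ↔
      ∃ h : G.Adj u v, ω v ⟨ident u, mem_nbrs_view.2 h⟩ = true := by
  simp [roundGraph, mem_nbrs_view]

variable (G ident)

/-- The coin that decides whether a dart is sampled. -/
def dartCoin : G.Dart ↪ Σ v : V, (view G ident v).nbrs where
  toFun d := ⟨d.snd, ident d.fst, mem_nbrs_view.2 d.adj⟩
  inj' := by
    rintro ⟨⟨x, y⟩, h⟩ ⟨⟨x', y'⟩, h'⟩ heq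
    obtain ⟨rfl, hx⟩ := Sigma.mk.inj_iff.1 heq
    obtain rfl := ident.injective (congrArg Subtype.val (eq_of_heq hx))
    rfl

theorem isBernoulliSubdigraph_roundGraph (p : unitInterval) :
    IsBernoulliSubdigraph G (roundLaw G ident p) p (roundGraph G ident) where
  adj h := (roundGraph_adj.1 h).1
  measurableSet_adj _ _ := .of_discrete
  measureReal_avoids A := by
    have hcoins := measureReal_pi_pi_bernoulliMeasure_forall_eq_false p (A.map (dartCoin G ident))
    rw [Finset.card_map] at hcoins
    rw [← hcoins, roundLaw]
    congr! 3 with ω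
    simp only [Finset.forall_mem_map]
    refine forall₂_congr fun d _ => ?_
    rw [roundGraph_adj, exists_prop_of_true d.adj, Bool.not_eq_true]
    rfl

theorem measureReal_sampling_eq (cp Cl : ℝ) (N t : ℕ) (F : Finset (Sym2 V))
    (adv : (sampling cp Cl N t).Adversary G ident)
    (Q : (Fin (numSubgraphs Cl N t) → Digraph V) → Prop) :
    ((sampling cp Cl N t).coinsLaw G ident).real
        {ω | Q (outputFamily ident ((sampling cp Cl N t).outputAt G ident F adv ω))} =
      (Measure.pi fun _ : Fin (numSubgraphs Cl N t) => roundLaw G ident (rate cp t)).real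
        {η | Q fun i => roundGraph G ident (η i)} := by
  have hswap := map_swap_pi_pi fun (v : V) (_ : Fin (numSubgraphs Cl N t)) =>
    Measure.pi fun _ : (view G ident v).nbrs => bernoulliMeasure true false (rate cp t)
  unfold roundLaw
  rw [← hswap, map_measureReal_apply .of_discrete .of_discrete]
  rfl

end Sampling

section Parameters

theorem coe_rate {cp : ℝ} {t : ℕ} (hcp : 0 ≤ cp) (ht : cp ≤ t) : (rate cp t : ℝ) = cp / t := by
  rw [rate, Set.projIcc_of_mem]
  exact ⟨by positivity, div_le_one_of_le₀ ht t.cast_nonneg⟩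

theorem numSubgraphs_le {a Cl : ℝ} (hCl : 0 ≤ Cl) {n N t : ℕ} (ht : 1 ≤ t) (hnN : n ≤ N)
    (hNa : (N : ℝ) ≤ (n : ℝ) ^ a) :
    (numSubgraphs Cl N t : ℝ) ≤ (Cl * a + 2) * t * Real.log n := by
  obtain hn | hn := Nat.lt_or_ge n 2
  · have hN : (N : ℝ) ≤ 1 := by
      interval_cases n
      · exact hNa.trans (by simpa using Real.zero_rpow_le_one a)
      · simpa using hNa
    have hN : N ≤ 1 := by exact_mod_cast hN
    have hlogn : Real.log n = 0 := by interval_cases n <;> simp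
    have hlogN : Real.log N = 0 := by interval_cases N <;> simp
    simp [numSubgraphs, hlogn, hlogN]
  · have hlogN : Real.log N ≤ a * Real.log n := by
      rw [← Real.log_rpow (by positivity)]
      exact Real.log_le_log (by exact_mod_cast (by omega : 0 < N)) hNa
    have hround : 1 ≤ 2 * t * Real.log n := by
      have ht' : (1 : ℝ) ≤ t := by exact_mod_cast ht
      nlinarith [half_le_log hn]
    calc (numSubgraphs Cl N t : ℝ) ≤ Cl * t * Real.log N + 1 :=
          (Nat.ceil_lt_add_one (mul_nonneg (by positivity) (Real.log_natCast_nonneg N))).le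
      _ ≤ Cl * t * (a * Real.log n) + 2 * t * Real.log n := by gcongr
      _ = (Cl * a + 2) * t * Real.log n := by ring

theorem card_sym2_le (α : Type*) [Fintype α] : Fintype.card (Sym2 α) ≤ Fintype.card α ^ 2 := by
  rw [sq, ← Fintype.card_prod]
  exact Fintype.card_le_of_surjective _ Sym2.mk_surjective

theorem half_pow_numSubgraphs_le {c : ℝ} (hc : 0 ≤ c) {n N t : ℕ} (hn : 2 ≤ n) (hnN : n ≤ N) :
    (1 / 2 : ℝ) ^ numSubgraphs (2 * (c + 6)) N t ≤ Real.exp (-((c + 6) * t * Real.log n)) := by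
  set l := numSubgraphs (2 * (c + 6)) N t
  have hl : 2 * (c + 6) * t * Real.log n ≤ l :=
    calc 2 * (c + 6) * t * Real.log n ≤ 2 * (c + 6) * t * Real.log N := by gcongr
      _ ≤ l := Nat.le_ceil _
  calc (1 / 2 : ℝ) ^ l ≤ Real.exp (-(1 / 2)) ^ l := by
        gcongr
        linarith [Real.add_one_le_exp (-(1 / 2 : ℝ))]
    _ = Real.exp (l * -(1 / 2)) := (Real.exp_nat_mul _ _).symm
    _ ≤ Real.exp (-((c + 6) * t * Real.log n)) := Real.exp_le_exp.2 (by linarith)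

theorem exp_mul_sq_pow_mul_half_pow_le {c : ℝ} (hc : 0 ≤ c) {n N t : ℕ} (ht : 1 ≤ t) (hn : 2 ≤ n)
    (hnN : n ≤ N) :
    Real.exp 1 * ((n : ℝ) ^ 2) ^ (2 * t) * (1 / 2) ^ numSubgraphs (2 * (c + 6)) N t ≤
      1 / (n : ℝ) ^ c := by
  have ht' : (1 : ℝ) ≤ t := by exact_mod_cast ht
  have hlog := half_le_log hn
  have hpow : ((n : ℝ) ^ 2) ^ (2 * t) = Real.exp (4 * t * Real.log n) := by
    rw [← pow_mul, ← Real.exp_log (by positivity : (0 : ℝ) < n ^ (2 * (2 * t))), Real.log_pow]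
    push_cast
    ring_nf
  have hrpow : 1 / (n : ℝ) ^ c = Real.exp (-(c * Real.log n)) := by
    rw [Real.rpow_def_of_pos (by positivity), one_div, ← Real.exp_neg, mul_comm c]
  have hexponent : 1 + 4 * t * Real.log n + -((c + 6) * t * Real.log n) ≤ -(c * Real.log n) := by
    have hround : 1 ≤ 2 * t * Real.log n := by nlinarith
    have hct : c * Real.log n * 1 ≤ c * Real.log n * t := by gcongr
    linarith
  calc Real.exp 1 * ((n : ℝ) ^ 2) ^ (2 * t) * (1 / 2) ^ numSubgraphs (2 * (c + 6)) N t
      ≤ Real.exp 1 * Real.exp (4 * t * Real.log n) *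
          Real.exp (-((c + 6) * t * Real.log n)) := by
        rw [hpow]
        gcongr
        exact half_pow_numSubgraphs_le hc hn hnN
    _ ≤ 1 / (n : ℝ) ^ c := by
        rw [hrpow, ← Real.exp_add, ← Real.exp_add, Real.exp_le_exp]
        exact hexponent

end Parameters

theorem IsBernoulliSubdigraph.measureReal_not_isDirectedCoveringFamily_le {V Ω : Type*} [Fintype V]
    {G : SimpleGraph V} [DecidableRel G.Adj] {mΩ : MeasurableSpace Ω} {μ : Measure Ω}
    [IsProbabilityMeasure μ] {D : Ω → Digraph V} {N t : ℕ} {c φ : ℝ}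
    (hD : IsBernoulliSubdigraph G μ (rate (1 / 16) t) D) (hc : 0 ≤ c) (ht : 1 ≤ t) (hφ : 0 < φ)
    (hV : 2 ≤ Fintype.card V) (hnN : Fintype.card V ≤ N) (hG : IsExpander G φ)
    (hΔ : 480 * t * Real.log (Fintype.card V) / φ ≤ G.minDegree) :
    (Measure.pi fun _ : Fin (numSubgraphs (2 * (c + 6)) N t) => μ).real
        {η | ¬ IsDirectedCoveringFamily G (36 * Real.log (Fintype.card V) / φ) (2 * t)
          fun i => D (η i)} ≤ 1 / (Fintype.card V : ℝ) ^ c := by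
  have : Nonempty V := Fintype.card_pos_iff.1 (by omega)
  have ht' : (1 : ℝ) ≤ t := by exact_mod_cast ht
  have hlog : 0 < Real.log (Fintype.card V) := by linarith [half_le_log hV]
  have hdeg : 0 < G.minDegree := by
    have : (0 : ℝ) < G.minDegree := lt_of_lt_of_le (by positivity) hΔ
    exact_mod_cast this
  have hp : (rate (1 / 16) t : ℝ) = 1 / 16 / t := coe_rate (by norm_num) (by linarith)
  have hrate : 30 * Real.log (Fintype.card V) ≤ rate (1 / 16) t * φ * G.minDegree :=
    calc 30 * Real.log (Fintype.card V)
        = rate (1 / 16) t * φ * (480 * t * Real.log (Fintype.card V) / φ) := by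
          rw [hp]
          field_simp
          norm_num
      _ ≤ rate (1 / 16) t * φ * G.minDegree := by
          gcongr
          exact mul_nonneg (rate (1 / 16) t).2.1 hφ.le
  have hcovers : ∀ E : Finset (Sym2 V), E.card ≤ 2 * t →
      μ.real {ω | ¬ Covers (36 * Real.log (Fintype.card V) / φ) E (D ω)} ≤ 1 / 2 := by
    intro E hE
    have hE' : (E.card : ℝ) ≤ 2 * t := by exact_mod_cast hE
    refine hD.measureReal_not_covers_le hV hG hφ hdeg hrate ?_
    rw [hp, ← mul_div_assoc, div_le_one (by positivity)]
    linarith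
  refine (AdvCongest.measureReal_not_isDirectedCoveringFamily_le (fun _ _ _ => hD.adj)
    hcovers _).trans ((exp_mul_sq_pow_mul_half_pow_le hc ht hV hnN).trans' ?_)
  rw [Fintype.card_fin]
  gcongr
  exact_mod_cast card_sym2_le V

end AdvCongest

open AdvCongest in
theorem mainTheorem6_general {a c : ℝ} (hc : 0 < c) {V : Type*} [Fintype V] {G : SimpleGraph V}
    [DecidableRel G.Adj] (ident : V ↪ ℕ) {N t : ℕ} {φ : ℝ} (ht : 1 ≤ t) (hφ : 0 < φ)
    (hnN : Fintype.card V ≤ N) (hNa : (N : ℝ) ≤ (Fintype.card V : ℝ) ^ a) (hG : IsExpander G φ)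
    (hΔ : 480 * t * Real.log (Fintype.card V) / φ ≤ G.minDegree) :
    (numSubgraphs (2 * (c + 6)) N t : ℝ) ≤
        (2 * (c + 6) * a + 2) * t * Real.log (Fintype.card V) ∧
      ∀ (F : Finset (Sym2 V)) (adv : (sampling (1 / 16) (2 * (c + 6)) N t).Adversary G ident),
        1 - 1 / (Fintype.card V : ℝ) ^ c ≤
          ((sampling (1 / 16) (2 * (c + 6)) N t).coinsLaw G ident).real
            {ω | IsDirectedCoveringFamily G (36 * Real.log (Fintype.card V) / φ) (2 * t)
              (outputFamily ident
                ((sampling (1 / 16) (2 * (c + 6)) N t).outputAt G ident F adv ω))} := by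
  refine ⟨numSubgraphs_le (by positivity) ht hnN hNa, fun F adv => ?_⟩
  rw [measureReal_sampling_eq G ident _ _ N t F adv (IsDirectedCoveringFamily G _ (2 * t))]
  obtain hV | hV | hV : Fintype.card V = 0 ∨ Fintype.card V = 1 ∨ 2 ≤ Fintype.card V := by omega
  · have := Fintype.card_eq_zero_iff.1 hV
    simp [IsDirectedCoveringFamily, Real.zero_rpow hc.ne']
  · simp [hV]
  · have hfail := (isBernoulliSubdigraph_roundGraph G ident
      (rate (1 / 16) t)).measureReal_not_isDirectedCoveringFamily_le hc.le ht hφ hV hnN hG hΔ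
    rw [← Set.compl_ofPred, probReal_compl_eq_one_sub .of_discrete] at hfail
    linarith

theorem mainTheorem6 (a c : ℝ) (ha : 1 ≤ a) (hc : 0 < c) :
    ∃ Cdeg cp Cl Cnum CL : ℝ, 0 < Cdeg ∧ 0 < cp ∧ 0 < Cl ∧ 0 < Cnum ∧ 0 < CL ∧
      ∀ (V : Type u) [Fintype V] (G : SimpleGraph V) [DecidableRel G.Adj]
        (ident : V ↪ ℕ) (N t : ℕ) (φ : ℝ),
        1 ≤ t → 0 < φ →
        Fintype.card V ≤ N → (N : ℝ) ≤ (Fintype.card V : ℝ) ^ a →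
        AdvCongest.IsExpander G φ →
        Cdeg * (t : ℝ) ^ 2 * Real.log (Fintype.card V) / φ ≤ (G.minDegree : ℝ) →
        (AdvCongest.numSubgraphs Cl N t : ℝ) ≤ Cnum * t * Real.log (Fintype.card V) ∧
        ∀ (F : Finset (Sym2 V)), (F : Set (Sym2 V)) ⊆ G.edgeSet → F.card ≤ t →
        ∀ adv : (AdvCongest.sampling cp Cl N t).Adversary G ident,
          1 - 1 / (Fintype.card V : ℝ) ^ c ≤
            ((AdvCongest.sampling cp Cl N t).coinsLaw G ident).real
              {ω | AdvCongest.IsDirectedCoveringFamily G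
                (CL * Real.log (Fintype.card V) / φ) (2 * t)
                (AdvCongest.outputFamily ident
                  ((AdvCongest.sampling cp Cl N t).outputAt G ident F adv ω))} := by
  refine ⟨480, 1 / 16, 2 * (c + 6), 2 * (c + 6) * a + 2, 36, by norm_num, by norm_num,
    by positivity, by positivity, by norm_num, ?_⟩
  intro V _ G _ ident N t φ ht hφ hnN hNa hG hΔ
  have hΔ' : 480 * t * Real.log (Fintype.card V) / φ ≤ G.minDegree := by
    refine le_trans ?_ hΔ
    gcongr
    exact le_self_pow₀ (by exact_mod_cast ht) two_ne_zero
  exact (mainTheorem6_general hc ident ht hφ hnN hNa hG hΔ').imp_right fun h F _ _ adv => h F adv
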